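/- Let $1\le p\le\infty$ and let $\ell^p$ be the complex Banach space of $p$-summable (bounded, if $p=\infty$) sequences $(x_i)_{i\ge 1}$. The Wiener algebra $\mathcal W$ consists of the Laurent series $a(z)=\sum_{j\in\mathbb Z}a_jz^j$ with complex coefficients such that $\sum_{j\in\mathbb Z}|a_j|<\infty$. For $a\in\mathcal W$ let $T(a)=[a_{j-i}]_{i,j\ge 1}$ be the Toeplitz operator on $\ell^p$ with symbol $a$, that is $(T(a)x)_i=\sum_{j\ge1}a_{j-i}x_j$; it is bounded. Let $\mathcal{QT}_p$ be the set of the operators $T(a)+E$ with $a\in\mathcal W$ and $E$ a compact operator on $\ell^p$. Let $A=T(a)+E_a$ and $B=T(b)+E_b$ be in $\mathcal{QT}_p$, with $a,b\in\mathcal W$ and $E_a,E_b$ compact. Assume that the Sylvester equation with coefficients $A,B$ is uniquely solvable, in either of the following senses: - $\sigma(A)\cap\sigma(-B)=\emptyset$, where $\sigma(M)=\{\lambda\in\mathbb C : \lambda I-M \text{ is not invertible}\}$ is the spectrum of the bounded operator $M$; or - for every $C\in\mathcal{QT}_p$ there is exactly one bounded operator $X$ on $\ell^p$ such that $AX+XB+C=0$.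 Then $a(z)+b(z)\neq 0$ for every $z\in\mathbb C$ with $|z|=1$. -/

import Mathlib

open scoped ENNReal

noncomputable section

namespace QuasiToeplitz

/-- The complex Banach space `ℓ^p` of semi-infinite sequences, with index set `ℕ`
(positions counted from `0`). -/
abbrev Ell (p : ℝ≥0∞) : Type := lp (fun _ : ℕ => ℂ) p

/-- A Laurent series `a(z) = ∑ a_j z^j`, given by its coefficients, is in the Wiener algebra. -/
def InWiener (a : ℤ → ℂ) : Prop := Summable fun j => ‖a j‖

/-- The value `a(z) = ∑_{j ∈ ℤ} a_j z^j`; the series converges absolutely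
for `a` in the Wiener algebra and `|z| = 1`. -/
def laurentEval (a : ℤ → ℂ) (z : ℂ) : ℂ := ∑' j : ℤ, a j * z ^ j

/-- The product of the Toeplitz matrix `[a_{j-i}]_{i,j}` with the column vector `x`. -/
def toeplitzMulVec (a : ℤ → ℂ) (x : ℕ → ℂ) (i : ℕ) : ℂ :=
  ∑' j : ℕ, a ((j : ℤ) - (i : ℤ)) * x j

/-- The sequence `i ↦ x_{i+k}`, with `0` where the index `i + k` is negative. -/
def shiftFun (k : ℤ) (x : ℕ → ℂ) (i : ℕ) : ℂ :=
  if 0 ≤ (i : ℤ) + k then x ((i : ℤ) + k).toNat else 0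

theorem sum_shiftFun_le (p : ℝ≥0∞) (hp : 0 < p.toReal) (k : ℤ) (x : Ell p) (s : Finset ℕ) :
    ∑ i ∈ s, ‖shiftFun k x i‖ ^ p.toReal ≤ ‖x‖ ^ p.toReal := by
  classical
  have h1 : ∑ i ∈ s, ‖shiftFun k x i‖ ^ p.toReal
      = ∑ i ∈ s.filter (fun i : ℕ => 0 ≤ (i : ℤ) + k), ‖x ((i : ℤ) + k).toNat‖ ^ p.toReal := by
    rw [Finset.sum_filter]
    refine Finset.sum_congr rfl fun i _ => ?_
    unfold shiftFun
    split_ifs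
    · rfl
    · rw [norm_zero, Real.zero_rpow hp.ne']
  have h2 : Set.InjOn (fun i : ℕ => ((i : ℤ) + k).toNat)
      (s.filter (fun i : ℕ => 0 ≤ (i : ℤ) + k) : Finset ℕ) := by
    intro i hi j hj hij
    simp only [Finset.coe_filter, Set.mem_ofPred_eq] at hi hj hij
    omega
  rw [h1, ← Finset.sum_image (f := fun n => ‖x n‖ ^ p.toReal) h2]
  exact lp.sum_rpow_le_norm_rpow hp x _

theorem norm_shiftFun_le_top (k : ℤ) (x : Ell ∞) (i : ℕ) : ‖shiftFun k x i‖ ≤ ‖x‖ := by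
  unfold shiftFun
  split_ifs
  · exact lp.norm_apply_le_norm (by simp) x _
  · simp

theorem memℓp_shiftFun (p : ℝ≥0∞) [hp : Fact (1 ≤ p)] (k : ℤ) (x : Ell p) :
    Memℓp (E := fun _ : ℕ => ℂ) (shiftFun k x) p := by
  rcases eq_or_ne p ∞ with rfl | h
  · refine memℓp_infty ⟨‖x‖, ?_⟩
    rintro _ ⟨i, rfl⟩
    exact norm_shiftFun_le_top k x i
  · have hp0 : 0 < p.toReal := ENNReal.toReal_pos (zero_lt_one.trans_le hp.out).ne' h
    exact memℓp_gen' (C := ‖x‖ ^ p.toReal) (sum_shiftFun_le p hp0 k x)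

/-- The shifted sequence as an element of `ℓ^p`. -/
def shift (p : ℝ≥0∞) [Fact (1 ≤ p)] (k : ℤ) (x : Ell p) : Ell p :=
  ⟨shiftFun k x, memℓp_shiftFun p k x⟩

theorem shift_apply (p : ℝ≥0∞) [Fact (1 ≤ p)] (k : ℤ) (x : Ell p) (i : ℕ) :
    shift p k x i = shiftFun k x i := rfl

theorem norm_shift_le (p : ℝ≥0∞) [hp : Fact (1 ≤ p)] (k : ℤ) (x : Ell p) :
    ‖shift p k x‖ ≤ ‖x‖ := by
  rcases eq_or_ne p ∞ with rfl | h
  · exact lp.norm_le_of_forall_le (norm_nonneg x) (norm_shiftFun_le_top k x)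
  · have hp0 : 0 < p.toReal := ENNReal.toReal_pos (zero_lt_one.trans_le hp.out).ne' h
    exact lp.norm_le_of_forall_sum_le hp0 (norm_nonneg x) (sum_shiftFun_le p hp0 k x)

theorem norm_smul_shift_le (p : ℝ≥0∞) [Fact (1 ≤ p)] (a : ℤ → ℂ) (x : Ell p) (k : ℤ) :
    ‖a k • shift p k x‖ ≤ ‖a k‖ * ‖x‖ := by
  rw [norm_smul]
  exact mul_le_mul_of_nonneg_left (norm_shift_le p k x) (norm_nonneg _)

theorem summable_smul_shift (p : ℝ≥0∞) [Fact (1 ≤ p)] {a : ℤ → ℂ} (ha : InWiener a)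
    (x : Ell p) : Summable fun k : ℤ => a k • shift p k x :=
  Summable.of_norm_bounded (ha.mul_right ‖x‖) (norm_smul_shift_le p a x)

theorem hasSum_toeplitz (p : ℝ≥0∞) [Fact (1 ≤ p)] {a : ℤ → ℂ} (ha : InWiener a)
    (x : Ell p) (i : ℕ) :
    HasSum (fun j : ℕ => a ((j : ℤ) - (i : ℤ)) * x j) ((∑' k : ℤ, a k • shift p k x : Ell p) i) := by
  have hc : Continuous fun y : Ell p => y i := (lp.lipschitzWith_one_eval p i).continuous
  let ev : Ell p →+ ℂ :=
    { toFun := fun y => y i, map_zero' := rfl, map_add' := fun _ _ => rfl }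
  have h1 : HasSum (fun k : ℤ => a k * shiftFun k x i)
      ((∑' k : ℤ, a k • shift p k x : Ell p) i) :=
    (summable_smul_shift p ha x).hasSum.map ev hc
  have hinj : Function.Injective fun j : ℕ => (j : ℤ) - (i : ℤ) := by
    intro j j' h
    simp only at h
    omega
  have h2 := (hinj.hasSum_iff (f := fun k : ℤ => a k * shiftFun k x i)
    (a := (∑' k : ℤ, a k • shift p k x : Ell p) i) ?_).2 h1
  · refine h2.congr_fun ?_
    intro j
    simp [shiftFun]
  · intro k hk
    have : ¬ 0 ≤ (i : ℤ) + k := fun h0 => hk ⟨((i : ℤ) + k).toNat, by simp only; omega⟩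
    simp [shiftFun, this]

theorem toeplitzMulVec_eq (p : ℝ≥0∞) [Fact (1 ≤ p)] {a : ℤ → ℂ} (ha : InWiener a) (x : Ell p) :
    toeplitzMulVec a x = (∑' k : ℤ, a k • shift p k x : Ell p) :=
  funext fun i => (hasSum_toeplitz p ha x i).tsum_eq

theorem memℓp_toeplitzMulVec (p : ℝ≥0∞) [Fact (1 ≤ p)] {a : ℤ → ℂ} (ha : InWiener a)
    (x : Ell p) : Memℓp (E := fun _ : ℕ => ℂ) (toeplitzMulVec a x) p := by
  rw [toeplitzMulVec_eq p ha x]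
  exact lp.memℓp _

/-- The Toeplitz operator `T(a)` on `ℓ^p` with symbol `a` in the Wiener algebra:
`(T(a) x)_i = ∑_j a_{j-i} x_j`. -/
def toeplitz (p : ℝ≥0∞) [Fact (1 ≤ p)] (a : ℤ → ℂ) (ha : InWiener a) : Ell p →L[ℂ] Ell p :=
  LinearMap.mkContinuous
    { toFun := fun x => ⟨toeplitzMulVec a x, memℓp_toeplitzMulVec p ha x⟩
      map_add' := fun x y => by
        ext i
        change toeplitzMulVec a (x + y : Ell p) i = toeplitzMulVec a x i + toeplitzMulVec a y i
        refine HasSum.tsum_eq ?_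
        have hx := (hasSum_toeplitz p ha x i).summable.hasSum
        have hy := (hasSum_toeplitz p ha y i).summable.hasSum
        refine (hx.add hy).congr_fun fun j => ?_
        simp [mul_add]
      map_smul' := fun c x => by
        ext i
        change toeplitzMulVec a (c • x : Ell p) i = c * toeplitzMulVec a x i
        refine HasSum.tsum_eq ?_
        have hx := (hasSum_toeplitz p ha x i).summable.hasSum
        refine (hx.mul_left c).congr_fun fun j => ?_
        simp [mul_left_comm] }
    (∑' k : ℤ, ‖a k‖)
    (fun x => by
      have h : (⟨toeplitzMulVec a x, memℓp_toeplitzMulVec p ha x⟩ : Ell p)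
          = ∑' k : ℤ, a k • shift p k x := Subtype.ext (toeplitzMulVec_eq p ha x)
      change ‖(⟨toeplitzMulVec a x, memℓp_toeplitzMulVec p ha x⟩ : Ell p)‖ ≤ _
      rw [h, ← tsum_mul_right]
      exact tsum_of_norm_bounded (ha.mul_right ‖x‖).hasSum (norm_smul_shift_le p a x))

/-- `A = T(a) + E` with `a` in the Wiener algebra and `E` compact on `ℓ^p`:
`A` is quasi-Toeplitz with symbol `a`. -/
def HasSymbol {p : ℝ≥0∞} [Fact (1 ≤ p)] (A : Ell p →L[ℂ] Ell p) (a : ℤ → ℂ) : Prop :=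
  ∃ (ha : InWiener a) (E : Ell p →L[ℂ] Ell p), IsCompactOperator E ∧ A = toeplitz p a ha + E

/-- The class `QT_p` of quasi-Toeplitz operators on `ℓ^p`. -/
def QT (p : ℝ≥0∞) [Fact (1 ≤ p)] : Set (Ell p →L[ℂ] Ell p) :=
  {A | ∃ a : ℤ → ℂ, HasSymbol A a}

/-- `X` is a (bounded) solution of the Sylvester equation `AX + XB + C = 0`. -/
def SolvesSylvester {p : ℝ≥0∞} [Fact (1 ≤ p)] (A B C X : Ell p →L[ℂ] Ell p) : Prop :=
  A ∘L X + X ∘L B + C = 0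

end QuasiToeplitz

end

/-!
The value `a(z)` of the symbol at a point of the unit circle is an approximate eigenvalue of every
operator `A = T(a) + E` with `E` compact, and also of its transpose `φ ↦ φ ∘ A`.

Both facts come from one abstract statement. A `ShiftFamily` is a family of contractions `R k`,
`k ∈ ℤ`, acting on a generating vector `e` as powers of a unilateral shift for `k ≥ 0` and of its
left inverse for `k ≤ 0`. On `ℓ^p` these are the shifts `x ↦ (x_{i-k})_i`, on the dual they are the
transposes of `x ↦ (x_{i+k})_i`; no description of the dual as a sequence space and no distinction
between values of `p` is needed. Such a family has approximate eigenvectors of `R 1` for each `ζ` on the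
circle, and they can be taken in the linear span of the `R j e`
(`ShiftFamily.exists_approx_eigenvector`). They are approximate eigenvectors of `∑ a_k R k` for
`a(ζ)` by dominated convergence (`ShiftFamily.exists_bound_hasSum`). For `p = 1` and `p = ∞` compact
perturbations need not be small on them, so differences of far translates are used: translates
stay uniformly separated, whereas a compact operator, or the transpose of one, sends two members
of a bounded sequence to points arbitrarily close together (`ShiftFamily.exists_approx_eigenvector_add`).

Suppose now `a(z) + b(z) = 0` and put `λ = a(z) = -b(z)`. Then `λ` lies in both `σ(A)` and `σ(-B)`,
which excludes the first hypothesis. Under the second one, the map `X ↦ AX + XB` is a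
bijection onto the compact operators from the closed subspace of those `X` whose image is compact,
so by the open mapping theorem `‖X‖ ≤ c ‖AX + XB‖` there
(`exists_norm_le_of_existsUnique_sylvester`). Take for `X` the rank one operator
`y ↦ φ(y) x`, with `x` an approximate eigenvector of `A` for `λ` and `φ` an approximate eigenvector
of the transpose of `B` for `-λ`: the image of `X` has finite rank and arbitrarily small norm
relative to `‖X‖ = ‖φ‖ ‖x‖`, a contradiction.
-/

noncomputable section

namespace QuasiToeplitz

variable {W : Type*} [NormedAddCommGroup W] [NormedSpace ℂ W]

/-! ### Abstract families of shifts and their approximate eigenvectors -/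

/-- Contractions `R k`, `k ∈ ℤ`, that behave as the powers of a unilateral shift: `R k` is a shift
by `k` places to the right for `k ≥ 0`, and to the left, dropping the entries that leave the index
set, for `k ≤ 0`. The vector `e` sits at position `0`, so that every left shift kills it. In
`comp_apply` the inner shift has to be to the right, where nothing is lost. -/
structure ShiftFamily (R : ℤ → W →L[ℂ] W) (e : W) : Prop where
  zero_apply : ∀ w, R 0 w = w
  norm_le : ∀ k w, ‖R k w‖ ≤ ‖w‖
  comp_apply : ∀ k l w, 0 ≤ l → R k (R l w) = R (k + l) w
  generator_ne_zero : e ≠ 0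
  apply_generator : ∀ k, k < 0 → R k e = 0

namespace ShiftFamily

variable {R : ℤ → W →L[ℂ] W} {e : W}

theorem norm_apply_of_nonneg (h : ShiftFamily R e) {k : ℤ} (hk : 0 ≤ k) (w : W) :
    ‖R k w‖ = ‖w‖ := by
  refine le_antisymm (h.norm_le k w) ?_
  have h1 := h.comp_apply (-k) k w hk
  rw [neg_add_cancel, h.zero_apply] at h1
  calc ‖w‖ = ‖R (-k) (R k w)‖ := by rw [h1]
    _ ≤ _ := h.norm_le _ _

/-- Twisting by a character of `ℤ` reduces approximate eigenvectors of `R 1` for `ζ` to the case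
`ζ = 1`. -/
theorem twist (h : ShiftFamily R e) {ζ : ℂ} (hζ : ‖ζ‖ = 1) :
    ShiftFamily (fun k => ζ ^ (-k) • R k) e where
  zero_apply w := by simp [h.zero_apply]
  norm_le k w := by
    simpa [norm_smul, hζ] using h.norm_le k w
  comp_apply k l w hl := by
    have h0 : ζ ≠ 0 := norm_ne_zero_iff.1 (by simp [hζ])
    simp only [smul_apply, map_smul, h.comp_apply k l w hl, smul_smul, ← zpow_add₀ h0]
    congr 2
    ring
  generator_ne_zero := h.generator_ne_zero
  apply_generator k hk := by simp [h.apply_generator k hk]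

/-- The operator `1 - R 1 ∘ R (-1)` extracts the entry at position `0`. -/
theorem coordinate_apply (h : ShiftFamily R e) (d : ℤ) :
    R d e - R 1 (R (-1) (R d e)) = if d = 0 then e else 0 := by
  rcases lt_trichotomy d 0 with hd | rfl | hd
  · simp [h.apply_generator d hd, hd.ne]
  · simp [h.zero_apply, h.apply_generator (-1) (by norm_num)]
  · rw [h.comp_apply _ _ _ hd.le, h.comp_apply _ _ _ (by omega)]
    simp [hd.ne']

/-- The case `ζ = 1` of `exists_approx_eigenvector`. If `R 1 - 1` were bounded below by `ε` on
finitely supported vectors, then `u = ∑_{j<n} R j e` and `v = ∑_{i<n} R i u` would satisfy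
`ε ‖u‖ ≤ 2 ‖e‖` and `ε ‖v‖ ≤ 2 ‖u‖` by telescoping, so `v` would be bounded independently of `n`;
but `v` has the entry `n` at position `n - 1`. The condition on `R (-d) w` says that `w` is supported
in the first `M` positions. -/
theorem exists_approx_fixed (h : ShiftFamily R e) {ε : ℝ} (hε : 0 < ε) :
    ∃ w, w ≠ 0 ∧ (∃ M : ℕ, ∀ d : ℤ, (M : ℤ) ≤ d → R (-d) w = 0) ∧ ‖R 1 w - w‖ ≤ ε * ‖w‖ := by
  by_contra! hcon
  have hbelow : ∀ w, (∃ M : ℕ, ∀ d : ℤ, (M : ℤ) ≤ d → R (-d) w = 0) →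
      ε * ‖w‖ ≤ ‖R 1 w - w‖ := by
    intro w hw
    rcases eq_or_ne w 0 with rfl | h0
    · simp
    · exact (hcon w h0 hw).le
  obtain ⟨n, hn⟩ := exists_nat_gt (8 / ε ^ 2)
  obtain ⟨m, rfl⟩ : ∃ m, n = m + 1 := by
    refine ⟨n - 1, (Nat.succ_pred_eq_of_pos ?_).symm⟩
    exact_mod_cast (show (0 : ℝ) < 8 / ε ^ 2 by positivity).trans hn
  have htel : ∀ w, R 1 (∑ j ∈ Finset.range (m + 1), R j w) - ∑ j ∈ Finset.range (m + 1), R j w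
      = R ((m + 1 : ℕ) : ℤ) w - w := by
    intro w
    rw [map_sum, ← Finset.sum_sub_distrib]
    have := Finset.sum_range_sub (fun j : ℕ => R (j : ℤ) w) (m + 1)
    simp only [Nat.cast_zero, h.zero_apply] at this
    rw [← this]
    refine Finset.sum_congr rfl fun j _ => ?_
    rw [h.comp_apply _ _ _ (by positivity)]
    push_cast
    rw [add_comm]
  have htel_norm : ∀ w, ‖R 1 (∑ j ∈ Finset.range (m + 1), R j w)
      - ∑ j ∈ Finset.range (m + 1), R j w‖ ≤ 2 * ‖w‖ := by
    intro w
    rw [htel]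
    linarith [norm_sub_le (R ((m + 1 : ℕ) : ℤ) w) w, h.norm_le ((m + 1 : ℕ) : ℤ) w]
  set u := ∑ j ∈ Finset.range (m + 1), R j e with hu
  set v := ∑ i ∈ Finset.range (m + 1), R i u with hv
  have hv' : v = ∑ i ∈ Finset.range (m + 1), ∑ j ∈ Finset.range (m + 1),
      R ((i : ℤ) + j) e := by
    simp only [hv, hu, map_sum]
    exact Finset.sum_congr rfl fun i _ => Finset.sum_congr rfl fun j _ =>
      h.comp_apply _ _ _ (by positivity)
  have hu0 : ε * ‖u‖ ≤ 2 * ‖e‖ := by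
    refine (hbelow u ⟨m + 1, fun d hd => ?_⟩).trans (htel_norm e)
    rw [hu, map_sum]
    refine Finset.sum_eq_zero fun j hj => ?_
    rw [h.comp_apply _ _ _ (by positivity)]
    refine h.apply_generator _ ?_
    have := Finset.mem_range.1 hj
    push_cast at hd
    omega
  have hv0 : ε * ‖v‖ ≤ 2 * ‖u‖ := by
    refine (hbelow v ⟨2 * m + 1, fun d hd => ?_⟩).trans (htel_norm u)
    rw [hv', map_sum]
    refine Finset.sum_eq_zero fun i hi => ?_
    rw [map_sum]
    refine Finset.sum_eq_zero fun j hj => ?_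
    rw [h.comp_apply _ _ _ (by positivity)]
    refine h.apply_generator _ ?_
    have := Finset.mem_range.1 hi
    have := Finset.mem_range.1 hj
    push_cast at hd
    omega
  -- The coordinate of `v` at position `m` is `m + 1`.
  have hcoord : R (-m) v - R 1 (R (-1) (R (-m) v)) = ((m + 1 : ℕ) : ℂ) • e := by
    have hsum : R (-m) v = ∑ i ∈ Finset.range (m + 1), ∑ j ∈ Finset.range (m + 1),
        R (-(m : ℤ) + (i + j)) e := by
      rw [hv', map_sum]
      refine Finset.sum_congr rfl fun i _ => ?_
      rw [map_sum]
      exact Finset.sum_congr rfl fun j _ => h.comp_apply _ _ _ (by positivity)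
    simp only [hsum, map_sum]
    rw [← Finset.sum_sub_distrib]
    have hrow : ∀ i ∈ Finset.range (m + 1),
        ((∑ j ∈ Finset.range (m + 1), R (-(m : ℤ) + (i + j)) e) -
          ∑ j ∈ Finset.range (m + 1), R 1 (R (-1) (R (-(m : ℤ) + (i + j)) e))) = e := by
      intro i hi
      have hi' := Finset.mem_range.1 hi
      rw [← Finset.sum_sub_distrib, Finset.sum_eq_single (m - i)]
      · rw [h.coordinate_apply, if_pos (by omega)]
      · intro j _ hj
        rw [h.coordinate_apply, if_neg (by omega)]
      · intro hj
        exact absurd (Finset.mem_range.2 (by omega)) hj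
    rw [Finset.sum_congr rfl hrow]
    simp [← Nat.cast_smul_eq_nsmul ℂ]
  have hlow : ((m + 1 : ℕ) : ℝ) * ‖e‖ ≤ 2 * ‖v‖ := by
    have h1 : ‖((m + 1 : ℕ) : ℂ) • e‖ = ((m + 1 : ℕ) : ℝ) * ‖e‖ := by
      rw [norm_smul, Complex.norm_natCast]
    rw [← h1, ← hcoord]
    linarith [norm_sub_le (R (-m) v) (R 1 (R (-1) (R (-m) v))), h.norm_le (-m) v,
      h.norm_le 1 (R (-1) (R (-m) v)), h.norm_le (-1) (R (-m) v)]
  have he : 0 < ‖e‖ := norm_pos_iff.2 h.generator_ne_zero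
  have h8 : ε ^ 2 * (((m + 1 : ℕ) : ℝ) * ‖e‖) ≤ 8 * ‖e‖ := by
    calc ε ^ 2 * (((m + 1 : ℕ) : ℝ) * ‖e‖) ≤ ε ^ 2 * (2 * ‖v‖) := by gcongr
      _ = 2 * (ε * (ε * ‖v‖)) := by ring
      _ ≤ 2 * (ε * (2 * ‖u‖)) := by gcongr
      _ = 4 * (ε * ‖u‖) := by ring
      _ ≤ 4 * (2 * ‖e‖) := by gcongr
      _ = 8 * ‖e‖ := by ring
  rw [div_lt_iff₀ (by positivity)] at hn
  nlinarith [mul_lt_mul_of_pos_right hn he]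

theorem exists_approx_eigenvector (h : ShiftFamily R e) {ζ : ℂ} (hζ : ‖ζ‖ = 1) {ε : ℝ}
    (hε : 0 < ε) :
    ∃ w, w ≠ 0 ∧ (∃ M : ℕ, ∀ d : ℤ, (M : ℤ) ≤ d → R (-d) w = 0) ∧
      ‖R 1 w - ζ • w‖ ≤ ε * ‖w‖ := by
  have h0 : ζ ≠ 0 := norm_ne_zero_iff.1 (by simp [hζ])
  obtain ⟨w, hw, ⟨M, hM⟩, hfix⟩ := (h.twist hζ).exists_approx_fixed hε
  refine ⟨w, hw, ⟨M, fun d hd => ?_⟩, ?_⟩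
  · have := hM d hd
    exact (smul_eq_zero.1 this).resolve_left (zpow_ne_zero _ h0)
  · have h1 : R 1 w - ζ • w = ζ • (ζ ^ (-1 : ℤ) • R 1 w - w) := by
      simp [smul_sub, smul_smul, h0]
    rw [h1, norm_smul, hζ, one_mul]
    simpa using hfix

theorem norm_apply_natCast_sub_le (h : ShiftFamily R e) {ζ : ℂ} (hζ : ‖ζ‖ = 1) (w : W) (n : ℕ) :
    ‖R n w - ζ ^ n • w‖ ≤ n * ‖R 1 w - ζ • w‖ := by
  induction n with
  | zero => simp [h.zero_apply]
  | succ n ih =>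
    have h1 : R ((n + 1 : ℕ) : ℤ) w - ζ ^ (n + 1) • w
        = R 1 (R n w - ζ ^ n • w) + ζ ^ n • (R 1 w - ζ • w) := by
      rw [map_sub, h.comp_apply _ _ _ (by positivity), map_smul, smul_sub, smul_smul, pow_succ]
      push_cast
      rw [add_comm (1 : ℤ)]
      abel
    rw [h1]
    refine (norm_add_le _ _).trans ?_
    have h2 := h.norm_le 1 (R n w - ζ ^ n • w)
    have h3 : ‖ζ ^ n • (R 1 w - ζ • w)‖ = ‖R 1 w - ζ • w‖ := by simp [norm_smul, hζ]
    push_cast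
    linarith

theorem norm_apply_sub_le (h : ShiftFamily R e) {ζ : ℂ} (hζ : ‖ζ‖ = 1) (w : W) (k : ℤ) :
    ‖R k w - ζ ^ k • w‖ ≤ |(k : ℝ)| * ‖R 1 w - ζ • w‖ := by
  have h0 : ζ ≠ 0 := norm_ne_zero_iff.1 (by simp [hζ])
  obtain ⟨n, rfl | rfl⟩ := k.eq_nat_or_neg
  · simpa using h.norm_apply_natCast_sub_le hζ w n
  · have h1 : R (-n) w - ζ ^ (-n : ℤ) • w = -(ζ ^ (-n : ℤ) • R (-n) (R n w - ζ ^ n • w)) := by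
      rw [map_sub, h.comp_apply _ _ _ (by positivity), neg_add_cancel, h.zero_apply, map_smul,
        smul_sub, smul_smul]
      simp [h0]
    rw [h1, norm_neg, norm_smul, norm_zpow, hζ, one_zpow, one_mul]
    refine (h.norm_le _ _).trans ?_
    simpa using h.norm_apply_natCast_sub_le hζ w n

/-- Approximate eigenvectors of `R 1` for `ζ` are approximate eigenvectors of `∑ a_k R k` for
`a(ζ)`, with an accuracy that does not depend on the vector. -/
theorem exists_bound_hasSum (h : ShiftFamily R e) {ζ : ℂ} (hζ : ‖ζ‖ = 1) {a : ℤ → ℂ}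
    (ha : InWiener a) {T : W →L[ℂ] W} (hT : ∀ w, HasSum (fun k => a k • R k w) (T w))
    {ε : ℝ} (hε : 0 < ε) :
    ∃ δ > 0, ∀ w, ‖R 1 w - ζ • w‖ ≤ δ * ‖w‖ → ‖T w - laurentEval a ζ • w‖ ≤ ε * ‖w‖ := by
  -- The error is at most `∑ ‖a k‖ min(2, |k| δ)`, which tends to `0` with `δ`.
  have hbound : ∀ (δ : ℝ) (k : ℤ), ‖‖a k‖ * min 2 (|(k : ℝ)| * |δ|)‖ ≤ ‖a k‖ * 2 := by
    intro δ k
    rw [Real.norm_of_nonneg (by positivity)]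
    gcongr
    exact min_le_left _ _
  have hlim : Filter.Tendsto (fun δ : ℝ => ∑' k : ℤ, ‖a k‖ * min 2 (|(k : ℝ)| * |δ|))
      (nhds 0) (nhds (∑' k : ℤ, (0 : ℝ))) := by
    refine tendsto_tsum_of_dominated_convergence (bound := fun k => ‖a k‖ * 2)
      (Summable.mul_right 2 ha) (fun k => ?_) (Filter.Eventually.of_forall hbound)
    have hc : Continuous fun δ : ℝ => ‖a k‖ * min 2 (|(k : ℝ)| * |δ|) := by fun_prop
    simpa using hc.tendsto 0
  rw [tsum_zero] at hlim
  obtain ⟨δ, hδ, hδε⟩ := (Metric.eventually_nhds_iff.1 (hlim.eventually (gt_mem_nhds hε)))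
  -- `δ` itself is not in the open ball of radius `δ`.
  refine ⟨δ / 2, by positivity, fun w hw => ?_⟩
  have hsumm : Summable fun k : ℤ => ‖a k‖ * min 2 (|(k : ℝ)| * |δ / 2|) :=
    Summable.of_norm_bounded (Summable.mul_right 2 ha) (hbound _)
  have heval : HasSum (fun k => a k * ζ ^ k) (laurentEval a ζ) := by
    refine Summable.hasSum (Summable.of_norm_bounded ha fun k => ?_)
    simp [hζ]
  have hdiff : HasSum (fun k => a k • (R k w - ζ ^ k • w)) (T w - laurentEval a ζ • w) := by
    refine ((hT w).sub (heval.smul_const w)).congr_fun fun k => ?_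
    rw [smul_sub, smul_smul]
  have hterm : ∀ k, ‖a k • (R k w - ζ ^ k • w)‖
      ≤ ‖a k‖ * min 2 (|(k : ℝ)| * |δ / 2|) * ‖w‖ := by
    intro k
    rw [norm_smul, mul_assoc]
    gcongr
    rw [min_mul_of_nonneg _ _ (norm_nonneg w)]
    refine le_min ?_ ?_
    · have h1 := norm_sub_le (R k w) (ζ ^ k • w)
      have h2 : ‖ζ ^ k • w‖ = ‖w‖ := by simp [norm_smul, hζ]
      linarith [h.norm_le k w]
    · refine (h.norm_apply_sub_le hζ w k).trans ?_
      rw [abs_of_pos (by positivity : 0 < δ / 2), mul_assoc]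
      gcongr
  have hle := tsum_of_norm_bounded (hsumm.mul_right ‖w‖).hasSum hterm
  rw [hdiff.tsum_eq, tsum_mul_right] at hle
  refine hle.trans ?_
  gcongr
  refine (hδε ?_).le
  rw [Real.dist_eq, sub_zero, abs_of_pos (by positivity)]
  linarith

/-- Translates of a vector supported in the first `M` positions by amounts that differ by at
least `M` are uniformly separated: shifting `R m w - R n w` back by `m` and then by `n - m` kills the
first translate and restores the second. -/
theorem norm_le_norm_apply_sub_apply (h : ShiftFamily R e) {w : W} {M : ℕ}
    (hM : ∀ d : ℤ, (M : ℤ) ≤ d → R (-d) w = 0) {m n : ℤ} (hm : 0 ≤ m) (hmn : m + M ≤ n) :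
    ‖w‖ ≤ ‖R m w - R n w‖ := by
  have h1 : R (-(n - m)) (R (-m) (R m w - R n w)) = -w := by
    have hn : 0 ≤ n := by omega
    have hd : 0 ≤ -m + n := by omega
    rw [map_sub, h.comp_apply _ _ _ hm, neg_add_cancel, h.zero_apply, h.comp_apply _ _ _ hn,
      map_sub, h.comp_apply _ _ _ hd, hM _ (by omega),
      show -(n - m) + (-m + n) = 0 by ring, h.zero_apply, zero_sub]
  calc ‖w‖ = ‖R (-(n - m)) (R (-m) (R m w - R n w))‖ := by rw [h1, norm_neg]
    _ ≤ ‖R m w - R n w‖ := (h.norm_le _ _).trans (h.norm_le _ _)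

end ShiftFamily

/-- Every bounded sequence has two members whose images under `K` are arbitrarily close. This weak
form of compactness holds for compact operators and for transposes of compact operators. -/
def MapsBoundedSeqClose (K : W →L[ℂ] W) : Prop :=
  ∀ x : ℕ → W, ∀ C : ℝ, (∀ n, ‖x n‖ ≤ C) → ∀ ε > 0, ∃ m n, m < n ∧ ‖K (x m) - K (x n)‖ ≤ ε

/-- The value `a(ζ)` is an approximate eigenvalue of `∑ a_k R k + K` if `K` satisfies the weak form
of compactness `MapsBoundedSeqClose`. The approximate eigenvector is a difference of two
translates, on which `K` is small. -/
theorem ShiftFamily.exists_approx_eigenvector_add {R : ℤ → W →L[ℂ] W} {e : W}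
    (h : ShiftFamily R e) {ζ : ℂ} (hζ : ‖ζ‖ = 1) {a : ℤ → ℂ}
    (ha : InWiener a) {T K : W →L[ℂ] W} (hT : ∀ w, HasSum (fun k => a k • R k w) (T w))
    (hK : MapsBoundedSeqClose K) {ε : ℝ} (hε : 0 < ε) :
    ∃ x, x ≠ 0 ∧ ‖(T + K) x - laurentEval a ζ • x‖ ≤ ε * ‖x‖ := by
  obtain ⟨δ, hδ, hT'⟩ := h.exists_bound_hasSum hζ ha hT (show 0 < ε / 3 by positivity)
  obtain ⟨w, hw, ⟨M, hM⟩, happ⟩ := h.exists_approx_eigenvector hζ hδ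
  have hw0 : 0 < ‖w‖ := norm_pos_iff.2 hw
  set x : ℕ → W := fun n => R (n * M : ℕ) w with hx
  have hxn : ∀ n, ‖x n‖ = ‖w‖ := fun n => h.norm_apply_of_nonneg (by positivity) w
  have hTx : ∀ n, ‖T (x n) - laurentEval a ζ • x n‖ ≤ ε / 3 * ‖w‖ := by
    intro n
    rw [← hxn n]
    refine hT' _ ?_
    have hcomm : R 1 (x n) - ζ • x n = R (n * M : ℕ) (R 1 w - ζ • w) := by
      rw [map_sub, map_smul, h.comp_apply _ _ _ zero_le_one, hx, h.comp_apply _ _ _ (by positivity),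
        add_comm]
    rw [hcomm, hxn]
    exact (h.norm_le _ _).trans happ
  obtain ⟨m, n, hmn, hclose⟩ := hK x ‖w‖ (fun n => (hxn n).le) (ε / 3 * ‖w‖) (by positivity)
  have hsep : ‖w‖ ≤ ‖x m - x n‖ := by
    refine h.norm_le_norm_apply_sub_apply hM (by positivity) ?_
    have : m * M + M ≤ n * M := by nlinarith
    exact_mod_cast this
  refine ⟨x m - x n, norm_pos_iff.1 (hw0.trans_le hsep), ?_⟩
  have hsplit : (T + K) (x m - x n) - laurentEval a ζ • (x m - x n)
      = (T (x m) - laurentEval a ζ • x m) - (T (x n) - laurentEval a ζ • x n)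
        + (K (x m) - K (x n)) := by
    simp only [add_apply, map_sub, smul_sub]
    abel
  rw [hsplit]
  calc _ ≤ ε / 3 * ‖w‖ + ε / 3 * ‖w‖ + ε / 3 * ‖w‖ :=
        (norm_add_le _ _).trans (add_le_add ((norm_sub_le _ _).trans
          (add_le_add (hTx m) (hTx n))) hclose)
    _ = ε * ‖w‖ := by ring
    _ ≤ _ := by gcongr

/-! ### Compact operators and their transposes on bounded sequences -/

theorem _root_.IsCompact.exists_lt_dist_le {Y : Type*} [PseudoMetricSpace Y] {s : Set Y}
    (hs : IsCompact s) {y : ℕ → Y} (hy : ∀ n, y n ∈ s) {ε : ℝ} (hε : 0 < ε) :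
    ∃ m n, m < n ∧ dist (y m) (y n) ≤ ε := by
  obtain ⟨l, -, φ, hφ, hlim⟩ := hs.tendsto_subseq hy
  obtain ⟨N, hN⟩ := Metric.cauchySeq_iff.1 hlim.cauchySeq ε hε
  exact ⟨φ N, φ (N + 1), hφ (Nat.lt_succ_self N), (hN N le_rfl (N + 1) (Nat.le_succ N)).le⟩

theorem mapsBoundedSeqClose_of_isCompactOperator {K : W →L[ℂ] W} (hK : IsCompactOperator K) :
    MapsBoundedSeqClose K := by
  intro x C hx ε hε
  obtain ⟨s, hs, hsub⟩ := hK.image_closedBall_subset_compact (f := (K : W →ₗ[ℂ] W)) C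
  have hmem : ∀ n, K (x n) ∈ s := fun n => hsub ⟨x n, by simpa using hx n, rfl⟩
  simpa only [dist_eq_norm] using hs.exists_lt_dist_le hmem hε

/-- The transpose `φ ↦ φ ∘ K` of a bounded operator, acting on the dual space. -/
def transpose (K : W →L[ℂ] W) : (W →L[ℂ] ℂ) →L[ℂ] (W →L[ℂ] ℂ) :=
  (ContinuousLinearMap.compL ℂ W W ℂ).flip K

theorem transpose_apply (K : W →L[ℂ] W) (φ : W →L[ℂ] ℂ) : transpose K φ = φ ∘L K := rfl

/-- The part of Schauder's theorem that is needed here: on a finite `η`-net of the image of the unit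
ball, two members of a bounded sequence of functionals have close values. -/
theorem mapsBoundedSeqClose_transpose {K : W →L[ℂ] W} (hK : IsCompactOperator K) :
    MapsBoundedSeqClose (transpose K) := by
  intro φ C hφ ε hε
  have hC : 0 ≤ C := (norm_nonneg _).trans (hφ 0)
  obtain ⟨s, hs, hsub⟩ := hK.image_closedBall_subset_compact (f := (K : W →ₗ[ℂ] W)) 1
  -- `C * η + C * η + η = ε`: two errors from passing to the net and one from the values on it.
  set η := ε / (2 * C + 1) with hη
  have hη0 : 0 < η := by positivity
  obtain ⟨t, -, ht, hcover⟩ := hs.finite_cover_balls hη0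
  have := ht.fintype
  -- Bounded sequences in the finite-dimensional space of values on the net `t`.
  have hval : ∀ n, (fun y : t => φ n y) ∈
      Set.pi Set.univ fun y : t => Metric.closedBall (0 : ℂ) (C * ‖(y : W)‖) := by
    intro n y _
    simpa using (φ n).le_of_opNorm_le (hφ n) y
  obtain ⟨m, n, hmn, hdist⟩ := (isCompact_univ_pi fun y : t =>
    isCompact_closedBall (0 : ℂ) (C * ‖(y : W)‖)).exists_lt_dist_le hval hη0
  refine ⟨m, n, hmn, ?_⟩
  refine ContinuousLinearMap.opNorm_le_of_unit_norm (𝕜 := ℂ) hε.le fun x hx => ?_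
  have hKx : K x ∈ s := hsub ⟨x, by simp [hx], rfl⟩
  obtain ⟨y, hy, hxy⟩ := Set.mem_iUnion₂.1 (hcover hKx)
  have h1 : ‖φ m y - φ n y‖ ≤ η := by
    rw [← dist_eq_norm]
    exact (dist_le_pi_dist (fun y : t => φ m y) (fun y : t => φ n y) ⟨y, hy⟩).trans hdist
  have h2 : ∀ k, ‖φ k (K x - y)‖ ≤ C * η := fun k =>
    ((φ k).le_of_opNorm_le (hφ k) _).trans (by
      gcongr
      rw [← dist_eq_norm]
      exact (Metric.mem_ball.1 hxy).le)
  have h3 : (transpose K (φ m) - transpose K (φ n)) x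
      = φ m (K x - y) - φ n (K x - y) + (φ m y - φ n y) := by
    change φ m (K x) - φ n (K x) = _
    rw [map_sub, map_sub]
    abel
  rw [h3]
  calc _ ≤ C * η + C * η + η :=
        (norm_add_le _ _).trans (add_le_add ((norm_sub_le _ _).trans
          (add_le_add (h2 m) (h2 n))) h1)
    _ = ε := by rw [hη]; field_simp; ring

/-! ### Shifts and Toeplitz operators on `ℓ^p` and on its dual -/

section Shift

variable (p : ℝ≥0∞) [Fact (1 ≤ p)]

/-- The shift `x ↦ (x_{i+k})_i` as a bounded operator on `ℓ^p`; for `k > 0` it shifts to the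
left. -/
def shiftCLM (k : ℤ) : Ell p →L[ℂ] Ell p :=
  LinearMap.mkContinuous
    { toFun := shift p k
      map_add' := fun x y => by
        ext i
        simp only [shift_apply, shiftFun, lp.coeFn_add, Pi.add_apply]
        split_ifs <;> simp
      map_smul' := fun c x => by
        ext i
        simp only [shift_apply, shiftFun, lp.coeFn_smul, Pi.smul_apply, RingHom.id_apply]
        split_ifs <;> simp }
    1 (fun x => by simpa using norm_shift_le p k x)

theorem shiftCLM_apply_apply (k : ℤ) (x : Ell p) (i : ℕ) :
    shiftCLM p k x i = if 0 ≤ (i : ℤ) + k then x ((i : ℤ) + k).toNat else 0 := rfl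

theorem shiftCLM_zero_apply (x : Ell p) : shiftCLM p 0 x = x := by
  ext i
  simp [shiftCLM_apply_apply]

theorem shiftCLM_comp_apply {k l : ℤ} (h : 0 ≤ k ∨ l ≤ 0) (x : Ell p) :
    shiftCLM p k (shiftCLM p l x) = shiftCLM p (k + l) x := by
  ext i
  simp only [shiftCLM_apply_apply]
  split_ifs with h1 h2 h3 h3 h3
  · refine congrArg (fun n : ℕ => (x n : ℂ)) ?_
    omega
  · omega
  · omega
  · rfl
  · omega
  · rfl

theorem norm_shiftCLM_le (k : ℤ) : ‖shiftCLM p k‖ ≤ 1 :=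
  LinearMap.mkContinuous_norm_le _ zero_le_one _

/-- The expansion `T(a) = ∑ a_k S_k` converges in operator norm, so it passes to the transpose. -/
theorem hasSum_toeplitz_shiftCLM {a : ℤ → ℂ} (ha : InWiener a) :
    HasSum (fun k => a k • shiftCLM p k) (toeplitz p a ha) := by
  have hs : Summable fun k => a k • shiftCLM p k := by
    refine Summable.of_norm_bounded ha fun k => ?_
    rw [norm_smul]
    exact mul_le_of_le_one_right (norm_nonneg _) (norm_shiftCLM_le p k)
  convert hs.hasSum
  ext1 x
  have h1 : HasSum (fun k => a k • shift p k x) ((∑' k, a k • shiftCLM p k) x) :=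
    hs.hasSum.mapL (ContinuousLinearMap.apply ℂ (Ell p) x)
  rw [← h1.tsum_eq]
  exact Subtype.ext (toeplitzMulVec_eq p ha x)

theorem hasSum_toeplitz_apply {a : ℤ → ℂ} (ha : InWiener a) (x : Ell p) :
    HasSum (fun k => a k • shiftCLM p k x) (toeplitz p a ha x) :=
  (hasSum_toeplitz_shiftCLM p ha).mapL (ContinuousLinearMap.apply ℂ (Ell p) x)

theorem hasSum_transpose_toeplitz {a : ℤ → ℂ} (ha : InWiener a) (φ : Ell p →L[ℂ] ℂ) :
    HasSum (fun k => a k • transpose (shiftCLM p k) φ) (transpose (toeplitz p a ha) φ) := by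
  refine ((hasSum_toeplitz_shiftCLM p ha).mapL
    (ContinuousLinearMap.compL ℂ (Ell p) (Ell p) ℂ φ)).congr_fun fun k => ?_
  rw [map_smul]
  rfl

/-- The sign of the index is reversed, since `shiftCLM p k` moves entries to the left for
`k > 0`. -/
theorem shiftFamily_shiftCLM_neg :
    ShiftFamily (fun k => shiftCLM p (-k)) (lp.single p 0 (1 : ℂ) : Ell p) where
  zero_apply x := shiftCLM_zero_apply p x
  norm_le k x := norm_shift_le p (-k) x
  comp_apply k l x hl := by
    rw [shiftCLM_comp_apply p (Or.inr (by omega)), neg_add]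
  generator_ne_zero h := by
    have := congrArg (fun x : Ell p => x 0) h
    simp at this
  apply_generator k hk := by
    ext i
    have : ((i : ℤ) + -k).toNat ≠ 0 := by omega
    simp [shiftCLM_apply_apply, this]

/-- On the dual, the transposed left shift moves the evaluation at position `i` to the evaluation
at `i + 1`. -/
theorem shiftFamily_transpose_shiftCLM :
    ShiftFamily (fun k => transpose (shiftCLM p k))
      (lp.evalCLM ℂ (fun _ : ℕ => ℂ) p 0) where
  zero_apply φ := by
    ext x
    simp only [transpose_apply, ContinuousLinearMap.comp_apply, shiftCLM_zero_apply]
  norm_le k φ := (φ.opNorm_comp_le _).trans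
    (mul_le_of_le_one_right (norm_nonneg _) (norm_shiftCLM_le p k))
  comp_apply k l φ hl := by
    ext x
    simp only [transpose_apply, ContinuousLinearMap.comp_apply]
    rw [shiftCLM_comp_apply p (Or.inl hl), add_comm]
  generator_ne_zero h := by
    have := congrArg (fun φ => φ (lp.single p 0 (1 : ℂ) : Ell p)) h
    change (lp.single p 0 (1 : ℂ) : Ell p) 0 = 0 at this
    simp at this
  apply_generator k hk := by
    ext x
    change shiftCLM p k x 0 = 0
    rw [shiftCLM_apply_apply, if_neg (by omega)]

end Shift

variable {p : ℝ≥0∞} [Fact (1 ≤ p)]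

theorem laurentEval_comp_neg (a : ℤ → ℂ) (z : ℂ) :
    laurentEval (fun k => a (-k)) z⁻¹ = laurentEval a z := by
  unfold laurentEval
  rw [← (Equiv.neg ℤ).tsum_eq]
  simp

theorem HasSymbol.exists_approx_eigenvector {A : Ell p →L[ℂ] Ell p} {a : ℤ → ℂ}
    (hA : HasSymbol A a) {z : ℂ} (hz : ‖z‖ = 1) {ε : ℝ} (hε : 0 < ε) :
    ∃ x, x ≠ 0 ∧ ‖A x - laurentEval a z • x‖ ≤ ε * ‖x‖ := by
  obtain ⟨ha, E, hE, rfl⟩ := hA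
  have ha' : InWiener fun k => a (-k) := (Equiv.neg ℤ).summable_iff.2 ha
  have hsum : ∀ x, HasSum (fun k => a (-k) • shiftCLM p (-k) x) (toeplitz p a ha x) := by
    intro x
    have h := (Equiv.neg ℤ).hasSum_iff (f := fun k => a k • shiftCLM p k x)
      (a := toeplitz p a ha x)
    exact h.2 (hasSum_toeplitz_apply p ha x)
  have hz' : ‖z⁻¹‖ = 1 := by simp [hz]
  have hlim := (shiftFamily_shiftCLM_neg p).exists_approx_eigenvector_add hz' ha'
    (T := toeplitz p a ha) (K := E) hsum (mapsBoundedSeqClose_of_isCompactOperator hE) hε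
  rwa [laurentEval_comp_neg] at hlim

theorem HasSymbol.exists_approx_eigenfunctional {B : Ell p →L[ℂ] Ell p} {b : ℤ → ℂ}
    (hB : HasSymbol B b) {z : ℂ} (hz : ‖z‖ = 1) {ε : ℝ} (hε : 0 < ε) :
    ∃ φ : Ell p →L[ℂ] ℂ, φ ≠ 0 ∧ ‖φ ∘L B - laurentEval b z • φ‖ ≤ ε * ‖φ‖ := by
  obtain ⟨hb, E, hE, rfl⟩ := hB
  obtain ⟨φ, h0, hφ⟩ := (shiftFamily_transpose_shiftCLM p).exists_approx_eigenvector_add hz hb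
    (T := transpose (toeplitz p b hb)) (fun φ => hasSum_transpose_toeplitz p hb φ)
    (mapsBoundedSeqClose_transpose hE) hε
  refine ⟨φ, h0, ?_⟩
  rw [ContinuousLinearMap.comp_add]
  exact hφ

/-! ### The spectrum and the Sylvester equation -/

theorem HasSymbol.laurentEval_mem_spectrum {A : Ell p →L[ℂ] Ell p} {a : ℤ → ℂ}
    (hA : HasSymbol A a) {z : ℂ} (hz : ‖z‖ = 1) : laurentEval a z ∈ spectrum ℂ A := by
  rw [spectrum.mem_iff]
  rintro ⟨u, hu⟩
  set C := ‖(↑u⁻¹ : Ell p →L[ℂ] Ell p)‖ with hC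
  obtain ⟨x, hx, hle⟩ := hA.exists_approx_eigenvector hz (ε := 1 / (C + 1)) (by positivity)
  have hx0 : 0 < ‖x‖ := norm_pos_iff.2 hx
  have h1 : (↑u⁻¹ : Ell p →L[ℂ] Ell p) ((u : Ell p →L[ℂ] Ell p) x) = x := by
    rw [← mul_apply_eq_comp, u.inv_mul, one_apply_eq_self]
  have h2 : ‖(u : Ell p →L[ℂ] Ell p) x‖ ≤ 1 / (C + 1) * ‖x‖ := by
    rw [hu, sub_apply, ContinuousLinearMap.algebraMap_apply, norm_sub_rev]
    exact hle
  have h3 : ‖x‖ ≤ C * (1 / (C + 1) * ‖x‖) := by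
    conv_lhs => rw [← h1]
    exact ((↑u⁻¹ : Ell p →L[ℂ] Ell p).le_opNorm _).trans (by gcongr)
  have h4 : C * (1 / (C + 1) * ‖x‖) = ‖x‖ - ‖x‖ / (C + 1) := by
    have : C + 1 ≠ 0 := by positivity
    field_simp
    ring
  have : 0 < ‖x‖ / (C + 1) := by positivity
  linarith

theorem hasSymbol_zero_of_isCompactOperator {C : Ell p →L[ℂ] Ell p} (hC : IsCompactOperator C) :
    HasSymbol C 0 := by
  refine ⟨by simp [InWiener, summable_zero], C, hC, ?_⟩
  have : toeplitz p 0 (by simp [InWiener, summable_zero]) = 0 := by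
    refine (hasSum_toeplitz_shiftCLM p _).unique ?_
    simp [hasSum_zero]
  rw [this, zero_add]

/-- The Sylvester operator `X ↦ AX + XB`. -/
def sylvester (A B : W →L[ℂ] W) : (W →L[ℂ] W) →L[ℂ] (W →L[ℂ] W) :=
  ContinuousLinearMap.compL ℂ W W W A + (ContinuousLinearMap.compL ℂ W W W).flip B

theorem sylvester_apply (A B X : W →L[ℂ] W) : sylvester A B X = A ∘L X + X ∘L B := rfl

/-- A bounded operator that is uniquely solvable for right-hand sides in a closed subspace is
bounded below on the preimage of that subspace, by the open mapping theorem. -/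
theorem exists_norm_le_of_existsUnique {E F : Type*} [NormedAddCommGroup E] [NormedSpace ℂ E]
    [CompleteSpace E] [NormedAddCommGroup F] [NormedSpace ℂ F] [CompleteSpace F] (f : E →L[ℂ] F)
    (K : Submodule ℂ F) (hK : IsClosed (K : Set F)) (h : ∀ y ∈ K, ∃! x, f x = y) :
    ∃ c : ℝ, 0 ≤ c ∧ ∀ x, f x ∈ K → ‖x‖ ≤ c * ‖f x‖ := by
  let N : Submodule ℂ E := K.comap f.toLinearMap
  have hN : IsClosed (N : Set E) := hK.preimage f.continuous
  have : CompleteSpace K := hK.completeSpace_coe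
  have : CompleteSpace N := hN.completeSpace_coe
  let g : N →L[ℂ] K := (f.comp N.subtypeL).codRestrict K fun x => x.2
  have hsurj : Function.Surjective g := by
    intro y
    obtain ⟨x, hx, -⟩ := h y y.2
    have hxy : f x = y := hx
    exact ⟨⟨x, show f x ∈ K from hxy ▸ y.2⟩, Subtype.ext hxy⟩
  obtain ⟨c, hc, hpre⟩ := g.exists_preimage_norm_le hsurj
  refine ⟨c, hc.le, fun x hx => ?_⟩
  obtain ⟨y, hy, hle⟩ := hpre ⟨f x, hx⟩
  have hyx : (y : E) = x := (h _ hx).unique (congrArg Subtype.val hy) rfl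
  calc ‖x‖ = ‖(y : E)‖ := by rw [hyx]
    _ ≤ c * ‖f x‖ := hle

theorem exists_norm_le_of_existsUnique_sylvester [CompleteSpace W] {A B : W →L[ℂ] W}
    (h : ∀ C : W →L[ℂ] W, IsCompactOperator C → ∃! X, sylvester A B X = C) :
    ∃ c : ℝ, 0 ≤ c ∧ ∀ X, IsCompactOperator (sylvester A B X) → ‖X‖ ≤ c * ‖sylvester A B X‖ :=
  exists_norm_le_of_existsUnique (sylvester A B) (compactOperator (RingHom.id ℂ) W W)
    isClosed_setOfPred_isCompactOperator h

/-- On the rank one operator `y ↦ φ(y) x`, the Sylvester operator is a sum of two rank one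
operators, each containing a defect of an eigenvector equation; the scalar `c` cancels. -/
theorem sylvester_smulRight (A B : W →L[ℂ] W) (φ : W →L[ℂ] ℂ) (x : W) (c : ℂ) :
    sylvester A B (φ.smulRight x)
      = φ.smulRight (A x - c • x) + (φ ∘L B + c • φ).smulRight x := by
  ext y
  simp only [sylvester_apply, add_apply, ContinuousLinearMap.comp_apply,
    ContinuousLinearMap.smulRight_apply, map_smul, smul_sub, add_smul, smul_apply, smul_eq_mul,
    mul_smul]
  rw [smul_comm c]
  abel

theorem isCompactOperator_smulRight (φ : W →L[ℂ] ℂ) (x : W) :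
    IsCompactOperator (φ.smulRight x) := by
  have h : IsCompactOperator (ContinuousLinearMap.toSpanSingleton ℂ x) :=
    isCompactOperator_of_locallyCompactSpace_rng _
  exact h.comp_clm φ

theorem laurentEval_add_ne_zero_of_existsUnique {A B : Ell p →L[ℂ] Ell p} {a b : ℤ → ℂ}
    (hA : HasSymbol A a) (hB : HasSymbol B b)
    (h : ∀ C : Ell p →L[ℂ] Ell p, IsCompactOperator C → ∃! X, sylvester A B X = C)
    {z : ℂ} (hz : ‖z‖ = 1) : laurentEval a z + laurentEval b z ≠ 0 := by
  intro hab
  obtain ⟨c, hc, hbound⟩ := exists_norm_le_of_existsUnique_sylvester h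
  -- Any `ε` with `2 c ε < 1` contradicts the bound on the rank one operator.
  set ε := 1 / (2 * c + 1) with hε
  have hε0 : 0 < ε := by positivity
  obtain ⟨x, hx, hxε⟩ := hA.exists_approx_eigenvector hz hε0
  obtain ⟨φ, hφ, hφε⟩ := hB.exists_approx_eigenfunctional hz hε0
  have hb : φ ∘L B - laurentEval b z • φ = φ ∘L B + laurentEval a z • φ := by
    rw [eq_neg_of_add_eq_zero_left hab]
    module
  rw [hb] at hφε
  have hx0 : 0 < ‖x‖ := norm_pos_iff.2 hx
  have hφ0 : 0 < ‖φ‖ := norm_pos_iff.2 hφ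
  have hS := sylvester_smulRight A B φ x (laurentEval a z)
  have hcomp : IsCompactOperator (sylvester A B (φ.smulRight x)) := by
    rw [hS]
    exact (isCompactOperator_smulRight _ _).add (isCompactOperator_smulRight _ _)
  have h1 := hbound _ hcomp
  have h2 : ‖sylvester A B (φ.smulRight x)‖ ≤ 2 * ε * (‖φ‖ * ‖x‖) := by
    rw [hS]
    refine (norm_add_le _ _).trans ?_
    rw [ContinuousLinearMap.norm_smulRight_apply, ContinuousLinearMap.norm_smulRight_apply]
    calc _ ≤ ‖φ‖ * (ε * ‖x‖) + ε * ‖φ‖ * ‖x‖ := by gcongr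
      _ = _ := by ring
  rw [ContinuousLinearMap.norm_smulRight_apply] at h1
  have h3 : ‖φ‖ * ‖x‖ ≤ c * (2 * ε * (‖φ‖ * ‖x‖)) := h1.trans (by gcongr)
  have h4 : c * (2 * ε * (‖φ‖ * ‖x‖)) = ‖φ‖ * ‖x‖ - ε * (‖φ‖ * ‖x‖) := by
    rw [hε]
    field_simp
    ring
  have : 0 < ε * (‖φ‖ * ‖x‖) := by positivity
  linarith

end QuasiToeplitz
end

theorem mainTheorem4 (p : ENNReal) [Fact (1 ≤ p)]
    (A B : QuasiToeplitz.Ell p →L[ℂ] QuasiToeplitz.Ell p) (a b : ℤ → ℂ)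
    (hA : QuasiToeplitz.HasSymbol A a) (hB : QuasiToeplitz.HasSymbol B b)
    (hwell : spectrum ℂ A ∩ spectrum ℂ (-B) = ∅ ∨
      ∀ C ∈ QuasiToeplitz.QT p, ∃! X, QuasiToeplitz.SolvesSylvester A B C X) :
    ∀ z : ℂ, ‖z‖ = 1 →
      QuasiToeplitz.laurentEval a z + QuasiToeplitz.laurentEval b z ≠ 0 := by
  intro z hz
  rcases hwell with hspec | hsolve
  · intro hab
    refine Set.eq_empty_iff_forall_notMem.1 hspec (QuasiToeplitz.laurentEval a z)
      ⟨hA.laurentEval_mem_spectrum hz, ?_⟩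
    rw [eq_neg_of_add_eq_zero_left hab, ← spectrum.neg_eq, Set.neg_mem_neg]
    exact hB.laurentEval_mem_spectrum hz
  · refine QuasiToeplitz.laurentEval_add_ne_zero_of_existsUnique hA hB (fun C hC => ?_) hz
    -- `C` enters the Sylvester equation with the opposite sign.
    have := hsolve (-C) ⟨0, QuasiToeplitz.hasSymbol_zero_of_isCompactOperator hC.neg⟩
    simpa only [QuasiToeplitz.SolvesSylvester, QuasiToeplitz.sylvester_apply,
      add_neg_eq_zero] using this
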